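/- Let $(\Omega,\mathcal F,\mathsf P)$ be a probability space that is atomless, i.e. every $A\in\mathcal F$ with $\mathsf P(A)>0$ is a union of two disjoint sets from $\mathcal F$ of positive probability. Let $L^0$ be the space of all real random variables and $\mathcal P$ the set of probability measures $\mathsf Q\ll\mathsf P$, identified with their densities $Z=d\mathsf Q/d\mathsf P$. All (conditional) expectations are understood as $\mathsf E X=\mathsf E X^+-\mathsf E X^-$ with values in $[-\infty,\infty]$ and the convention $\infty-\infty=-\infty$. A coherent utility function on $L^0$ is a map $u\colon L^0\to[-\infty,\infty]$ of the form $u(X)=\inf_{\mathsf Q\in\mathcal D}\mathsf E_{\mathsf Q}X$, $X\in L^0$, with some non-empty $\mathcal D\subseteq\mathcal P$. Its determining set is the largest such $\mathcal D$, namely $\mathcal D=\{\mathsf Q\in\mathcal P:\mathsf E_{\mathsf Q}X\ge u(X)\ \text{for all }X\in L^0\}$. The corresponding coherent risk measure is $\rho=-u$. The utility $u$ is law invariant if $u(X)=u(X')$ whenever $X$ and $X'$ have the same distribution under $\mathsf P$. For a random vector $Y$, the factor utility is $$u^f(X;Y)=\inf_{\mathsf Q\in\mathsf E(\mathcal D\mid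 Y)}\mathsf E_{\mathsf Q}X,\qquad \mathsf E(\mathcal D\mid Y)=\{\mathsf E(Z\mid Y):Z\in\mathcal D\},$$ where $\mathcal D$ is the determining set of $u$; $u^f(X;Y,Y')$ denotes the factor utility for the compound random vector $(Y,Y')$. **Theorem 3.7.** Let $(\Omega,\mathcal F,\mathsf P)$ be atomless and let $u$ be a law invariant coherent utility function on $L^0$. Then: 1. for every random variable $X\in L^0$ and all (finite-dimensional) random vectors $Y,Y'$, $$u^f(X;Y,Y')\le u^f(X;Y);$$ 2. the risk measure $\rho=-u$ is dilatation monotone: $\rho(\mathsf E(X\mid\mathcal G))\le\rho(X)$ for every sub-$\sigma$-field $\mathcal G\subseteq\mathcal F$ and every $X\in L^0$ whose conditional expectation $\mathsf E(X\mid\mathcal G)$ is almost surely finite (so that it belongs to $L^0$); in particular, for every $X\in L^1$. -/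

import Mathlib

open MeasureTheory
open scoped ENNReal

/-- A measure space is atomless if every measurable set of positive measure splits into two disjoint
measurable pieces of positive measure. -/
def IsAtomless {Ω : Type*} [MeasurableSpace Ω] (P : Measure Ω) : Prop :=
  ∀ A : Set Ω, MeasurableSet A → 0 < P A →
    ∃ A₁ A₂ : Set Ω, MeasurableSet A₁ ∧ MeasurableSet A₂ ∧ A₁ ∪ A₂ = A ∧ Disjoint A₁ A₂ ∧
      0 < P A₁ ∧ 0 < P A₂

/-- The set `𝒫` of probability measures that are absolutely continuous with respect to `P`. -/
def acProbabilities {Ω : Type*} [MeasurableSpace Ω] (P : Measure Ω) : Set (Measure Ω) :=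
  {Q | IsProbabilityMeasure Q ∧ Q ≪ P}

/-- The expectation `E_Q X = E_Q X⁺ - E_Q X⁻` in `[-∞, ∞]` of an arbitrary real random variable,
with the convention `∞ - ∞ = -∞` (this is the subtraction of `EReal`). -/
noncomputable def extExpectation {Ω : Type*} [MeasurableSpace Ω] (Q : Measure Ω) (X : Ω → ℝ) :
    EReal :=
  ((∫⁻ ω, ENNReal.ofReal (X ω) ∂Q : ℝ≥0∞) : EReal) -
    ((∫⁻ ω, ENNReal.ofReal (-X ω) ∂Q : ℝ≥0∞) : EReal)

/-- The set `D` represents `u` on `L⁰`: `u X = inf_{Q ∈ D} E_Q X` for every random variable `X`. -/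
def Represents {Ω : Type*} [MeasurableSpace Ω] (D : Set (Measure Ω)) (u : (Ω → ℝ) → EReal) :
    Prop :=
  ∀ X : Ω → ℝ, Measurable X → u X = ⨅ Q ∈ D, extExpectation Q X

/-- `u` is a coherent utility function on `L⁰`: it is represented by some non-empty set of
probability measures that are absolutely continuous with respect to `P`.
Only the values of `u` at measurable functions matter. -/
def IsCoherentUtility {Ω : Type*} [MeasurableSpace Ω] (P : Measure Ω) (u : (Ω → ℝ) → EReal) :
    Prop :=
  ∃ D : Set (Measure Ω), D.Nonempty ∧ D ⊆ acProbabilities P ∧ Represents D u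

/-- The determining set of `u`, i.e. the largest subset of `𝒫` that represents `u`
(see `isGreatest_determiningSet`). -/
def determiningSet {Ω : Type*} [MeasurableSpace Ω] (P : Measure Ω) (u : (Ω → ℝ) → EReal) :
    Set (Measure Ω) :=
  {Q | Q ∈ acProbabilities P ∧ ∀ X : Ω → ℝ, Measurable X → u X ≤ extExpectation Q X}

theorem isGreatest_determiningSet {Ω : Type*} [MeasurableSpace Ω] {P : Measure Ω}
    {u : (Ω → ℝ) → EReal} (hu : IsCoherentUtility P u) :
    IsGreatest {D : Set (Measure Ω) | D.Nonempty ∧ D ⊆ acProbabilities P ∧ Represents D u}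
      (determiningSet P u) := by
  have key : ∀ D : Set (Measure Ω), D ⊆ acProbabilities P → Represents D u →
      D ⊆ determiningSet P u := fun D hD hr Q hQ =>
    ⟨hD hQ, fun X hX => (hr X hX).le.trans (iInf₂_le Q hQ)⟩
  obtain ⟨D, hne, hD, hr⟩ := hu
  refine ⟨⟨hne.mono (key D hD hr), fun Q hQ => hQ.1, fun X hX => le_antisymm ?_ ?_⟩, ?_⟩
  · exact le_iInf₂ fun Q hQ => hQ.2 X hX
  · rw [hr X hX]
    exact le_iInf₂ fun Q hQ => iInf₂_le Q (key D hD hr hQ)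
  · rintro D' ⟨-, hD', hr'⟩
    exact key D' hD' hr'

/-- A functional on `L⁰` is law invariant if its value at `X` depends only on the distribution
of `X` under `P`. -/
def IsLawInvariant {Ω : Type*} [MeasurableSpace Ω] (P : Measure Ω) (u : (Ω → ℝ) → EReal) : Prop :=
  ∀ X X' : Ω → ℝ, Measurable X → Measurable X' → P.map X = P.map X' → u X = u X'

/-- For `Q = Z P`, the measure `E(Z | Y) P`, where `E(Z | Y)` is the conditional expectation of the
density `Z` with respect to `P` and the σ-algebra generated by `Y`. -/
noncomputable def condMeasure {Ω E : Type*} [MeasurableSpace Ω] [mE : MeasurableSpace E]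
    (P : Measure Ω) (Y : Ω → E) (Q : Measure Ω) : Measure Ω :=
  P.withDensity (condLExp (mE.comap Y) P (Q.rnDeriv P))

/-- The factor utility `u^f(X; Y) = inf_{Q ∈ E(D | Y)} E_Q X`, where `D` is the determining set
of `u` and `E(D | Y) = {E(Z | Y) : Z ∈ D}`, measures being identified with their densities. -/
noncomputable def factorUtility {Ω E : Type*} [MeasurableSpace Ω] [MeasurableSpace E]
    (P : Measure Ω) (u : (Ω → ℝ) → EReal) (X : Ω → ℝ) (Y : Ω → E) : EReal :=
  ⨅ Q ∈ condMeasure P Y '' determiningSet P u, extExpectation Q X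

/-- The conditional expectation `E(X | m) = E(X⁺ | m) - E(X⁻ | m)` under `P`, with values
in `[-∞, ∞]` and with the convention `∞ - ∞ = -∞`, of an arbitrary real random variable. -/
noncomputable def extCondExp {Ω : Type*} {_ : MeasurableSpace Ω} (P : Measure Ω)
    (m : MeasurableSpace Ω) (X : Ω → ℝ) (ω : Ω) : EReal :=
  (condLExp m P (fun ω' => ENNReal.ofReal (X ω')) ω : EReal) -
    (condLExp m P (fun ω' => ENNReal.ofReal (-X ω')) ω : EReal)

/-- A functional `ρ` on `L⁰` is dilatation monotone if `ρ(E(X | m)) ≤ ρ(X)` for every sub-σ-algebra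
`m` and every random variable `X` whose conditional expectation `V = E(X | m)` is again
a (finite) random variable; this holds in particular for every integrable `X`. -/
def IsDilatationMonotone {Ω : Type*} [mΩ : MeasurableSpace Ω] (P : Measure Ω)
    (ρ : (Ω → ℝ) → EReal) : Prop :=
  ∀ X V : Ω → ℝ, Measurable X → Measurable V → ∀ m : MeasurableSpace Ω, m ≤ mΩ →
    (∀ᵐ ω ∂P, (V ω : EReal) = extCondExp P m X ω) → ρ V ≤ ρ X

/-! The crux is that the determining set D is stable under conditioning: if Z ∈ D, then E(Z | m) ∈
D. Given X, take a copy X' of X that is antimonotone to Z. Law invariance gives u(X) = u(X') ≤ E[Z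
X'], and it remains to see that E[Z X'] ≤ E[E(Z | m) X]. This is checked level by level: with φ =
P(X < s | m), self-adjointness of conditional expectation gives E[E(Z | m); X < s] = E[Z φ], which
by Hardy-Littlewood is at most E[Z; X' < s].

The copy X' comes from a maximal chain of events through the superlevel sets of Z. Without atoms the
chain has events of every probability, from which the sublevel sets of X' are built.

Stability gives both claims. E(Z | Y) lies in D and is fixed by conditioning on (Y, Y'), so E(D | Y)
⊆ E(D | Y, Y'). For V = E(X | m) and Q' the conditioned Q, E_Q V ≥ E_{Q'} X ≥ u(X) for every Q ∈ D.
-/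

open Set Filter

/-! ### Maximal chains of events modulo null sets -/

section Chains

variable {Ω : Type*} [MeasurableSpace Ω] {P : Measure Ω}

/-- Almost sure inclusion of measurable sets. -/
def AESubset (P : Measure Ω) (A B : {A : Set Ω // MeasurableSet A}) : Prop :=
  (A : Set Ω) ≤ᵐ[P] (B : Set Ω)

theorem measure_iUnion_of_ae_mono {ι : Type*} [LinearOrder ι] [Countable ι] {f : ι → Set Ω}
    (hf : ∀ i j, i ≤ j → f i ≤ᵐ[P] f j) : P (⋃ i, f i) = ⨆ i, P (f i) := by
  rw [measure_iUnion_eq_iSup_accumulate]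
  refine iSup_congr fun i => le_antisymm (measure_mono_ae ?_) (measure_mono (subset_accumulate))
  have h : ∀ᵐ ω ∂P, ∀ j, j ≤ i → ω ∈ f j → ω ∈ f i :=
    ae_all_iff.2 fun j => by
      by_cases hj : j ≤ i
      · filter_upwards [hf j i hj] with ω hω _ using hω
      · exact ae_of_all _ fun ω h => absurd h hj
  filter_upwards [h] with ω hω hmem
  obtain ⟨j, hj, hωj⟩ := mem_accumulate.1 hmem
  exact hω j hj hωj

variable {M : Set {A : Set Ω // MeasurableSet A}}

theorem aesubset_refl (A : {A : Set Ω // MeasurableSet A}) : AESubset P A A :=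
  EventuallyLE.refl _ _

theorem IsMaxChain.aesubset_total (hM : IsMaxChain (AESubset P) M)
    {A B : {A : Set Ω // MeasurableSet A}} (hA : A ∈ M) (hB : B ∈ M) :
    AESubset P A B ∨ AESubset P B A := by
  by_cases h : A = B
  · exact Or.inl (h ▸ aesubset_refl A)
  · exact hM.isChain hA hB h

theorem IsMaxChain.mem_of_aesubset_total (hM : IsMaxChain (AESubset P) M)
    {A : {A : Set Ω // MeasurableSet A}} (h : ∀ C ∈ M, AESubset P A C ∨ AESubset P C A) :
    A ∈ M := by
  rw [hM.2 (hM.isChain.insert fun C hC _ => h C hC) (subset_insert A M)]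
  exact mem_insert A M

/-- A member C of the chain either lies below some `f i`, hence below the union, or lies above all
of them; countability lets the null sets be discarded together. -/
theorem IsMaxChain.iUnion_mem (hM : IsMaxChain (AESubset P) M) {ι : Type*} [Countable ι]
    {f : ι → {A : Set Ω // MeasurableSet A}} (hf : ∀ i, f i ∈ M) :
    (⟨⋃ i, (f i : Set Ω), MeasurableSet.iUnion fun i => (f i).2⟩ :
      {A : Set Ω // MeasurableSet A}) ∈ M := by
  refine hM.mem_of_aesubset_total fun C hC => ?_
  by_cases h : ∃ i, AESubset P C (f i)
  · obtain ⟨i, hi⟩ := h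
    right
    filter_upwards [hi] with ω hω hmem using mem_iUnion.2 ⟨i, hω hmem⟩
  · push Not at h
    left
    have h' : ∀ᵐ ω ∂P, ∀ i, ω ∈ (f i : Set Ω) → ω ∈ (C : Set Ω) :=
      ae_all_iff.2 fun i => (hM.aesubset_total (hf i) hC).resolve_right (h i)
    filter_upwards [h'] with ω hω hmem
    obtain ⟨i, hi⟩ := mem_iUnion.1 hmem
    exact hω i hi

theorem IsMaxChain.iInter_mem (hM : IsMaxChain (AESubset P) M) {ι : Type*} [Countable ι]
    {f : ι → {A : Set Ω // MeasurableSet A}} (hf : ∀ i, f i ∈ M) :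
    (⟨⋂ i, (f i : Set Ω), MeasurableSet.iInter fun i => (f i).2⟩ :
      {A : Set Ω // MeasurableSet A}) ∈ M := by
  refine hM.mem_of_aesubset_total fun C hC => ?_
  by_cases h : ∃ i, AESubset P (f i) C
  · obtain ⟨i, hi⟩ := h
    left
    filter_upwards [hi] with ω hω hmem using hω (mem_iInter.1 hmem i)
  · push Not at h
    right
    have h' : ∀ᵐ ω ∂P, ∀ i, ω ∈ (C : Set Ω) → ω ∈ (f i : Set Ω) :=
      ae_all_iff.2 fun i => (hM.aesubset_total (hf i) hC).resolve_left (h i)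
    filter_upwards [h'] with ω hω hmem
    exact mem_iInter.2 fun i => hω i hmem

theorem IsMaxChain.aesubset_of_measure_le [IsFiniteMeasure P] (hM : IsMaxChain (AESubset P) M)
    {A B : {A : Set Ω // MeasurableSet A}} (hA : A ∈ M) (hB : B ∈ M)
    (h : P (A : Set Ω) ≤ P (B : Set Ω)) : AESubset P A B := by
  rcases hM.aesubset_total hA hB with h' | h'
  · exact h'
  · exact (ae_eq_of_ae_subset_of_measure_ge h' h B.2.nullMeasurableSet
      (measure_ne_top P _)).symm.le

theorem IsMaxChain.exists_greatest_measure_le [IsFiniteMeasure P]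
    (hM : IsMaxChain (AESubset P) M) (t : ℝ≥0∞) :
    ∃ A ∈ M, P (A : Set Ω) ≤ t ∧ ∀ C ∈ M, P (C : Set Ω) ≤ t → AESubset P C A := by
  let S : Set ℝ≥0∞ := {x | ∃ A ∈ M, P (A : Set Ω) ≤ t ∧ P (A : Set Ω) = x}
  have hne : S.Nonempty := by
    refine ⟨0, ⟨∅, MeasurableSet.empty⟩, hM.mem_of_aesubset_total fun C _ => Or.inl ?_, ?_, ?_⟩
    · exact ae_of_all _ fun ω h => absurd h (notMem_empty ω)
    · simp
    · simp
  obtain ⟨x, hmono, htends, hx⟩ := exists_seq_tendsto_sSup hne (OrderTop.bddAbove _)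
  choose f hfM hft hfx using hx
  have hae : ∀ i j, i ≤ j → (f i : Set Ω) ≤ᵐ[P] (f j : Set Ω) := fun i j hij =>
    hM.aesubset_of_measure_le (hfM i) (hfM j) (by rw [hfx, hfx]; exact hmono hij)
  have hP := measure_iUnion_of_ae_mono hae
  refine ⟨_, hM.iUnion_mem hfM, ?_, fun C hC hCt =>
    hM.aesubset_of_measure_le hC (hM.iUnion_mem hfM) ?_⟩
  · simp only [hP]
    exact iSup_le hft
  · refine (le_sSup (show P (C : Set Ω) ∈ S from ⟨C, hC, hCt, rfl⟩)).trans ?_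
    refine le_of_tendsto' htends fun n => ?_
    rw [← hfx n]
    exact measure_mono (subset_iUnion (fun i => (f i : Set Ω)) n)

theorem IsMaxChain.exists_least_lt_measure [IsFiniteMeasure P]
    (hM : IsMaxChain (AESubset P) M) {t : ℝ≥0∞} (ht : t < P univ) :
    ∃ A ∈ M, t ≤ P (A : Set Ω) ∧ ∀ C ∈ M, t < P (C : Set Ω) → AESubset P A C := by
  let S : Set ℝ≥0∞ := {x | ∃ A ∈ M, t < P (A : Set Ω) ∧ P (A : Set Ω) = x}
  have hne : S.Nonempty := by
    refine ⟨P univ, ⟨univ, MeasurableSet.univ⟩,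
      hM.mem_of_aesubset_total fun C _ => Or.inr ?_, ht, rfl⟩
    exact ae_of_all _ fun ω _ => mem_univ ω
  obtain ⟨x, hanti, htends, hx⟩ := exists_seq_tendsto_sInf hne (OrderBot.bddBelow _)
  choose f hfM hft hfx using hx
  have hae : ∀ i j, i ≤ j → (f j : Set Ω) ≤ᵐ[P] (f i : Set Ω) := fun i j hij =>
    hM.aesubset_of_measure_le (hfM j) (hfM i) (by rw [hfx, hfx]; exact hanti hij)
  refine ⟨_, hM.iInter_mem hfM, ?_, fun C hC hCt =>
    hM.aesubset_of_measure_le (hM.iInter_mem hfM) hC ?_⟩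
  · rw [measure_iInter_eq_iInf_measure_iInter_le (fun i => (f i).2.nullMeasurableSet)
      ⟨0, measure_ne_top P _⟩]
    refine le_iInf fun i => (hft i).le.trans (measure_mono_ae ?_)
    have h : ∀ᵐ ω ∂P, ∀ j, j ≤ i → ω ∈ (f i : Set Ω) → ω ∈ (f j : Set Ω) :=
      ae_all_iff.2 fun j => by
        by_cases hj : j ≤ i
        · filter_upwards [hae j i hj] with ω hω _ using hω
        · exact ae_of_all _ fun ω h => absurd h hj
    filter_upwards [h] with ω hω hmem
    exact mem_iInter₂.2 fun j hj => hω j hj hmem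
  · refine le_trans ?_ (sInf_le (show P (C : Set Ω) ∈ S from ⟨C, hC, hCt, rfl⟩))
    refine ge_of_tendsto' htends fun n => ?_
    rw [← hfx n]
    exact measure_mono (iInter_subset (fun i => (f i : Set Ω)) n)

/-- In an atomless finite measure space a maximal chain of measurable sets contains sets of every
possible measure. -/
theorem IsMaxChain.exists_measure_eq [IsFiniteMeasure P] (hP : IsAtomless P)
    (hM : IsMaxChain (AESubset P) M) {t : ℝ≥0∞} (ht : t ≤ P univ) :
    ∃ A ∈ M, P (A : Set Ω) = t := by
  -- At the top level no event has measure above `t`, so this case is separate.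
  rcases ht.eq_or_lt with rfl | ht
  · exact ⟨⟨univ, MeasurableSet.univ⟩, hM.mem_of_aesubset_total fun C _ =>
      Or.inr (ae_of_all _ fun ω _ => mem_univ ω), rfl⟩
  obtain ⟨A, hA, hAt, hAmax⟩ := hM.exists_greatest_measure_le t
  obtain ⟨B, hB, hBt, hBmin⟩ := hM.exists_least_lt_measure ht
  by_contra! hne
  have hlt : P (A : Set Ω) < t := lt_of_le_of_ne hAt (hne A hA)
  have hAB : AESubset P A B := hM.aesubset_of_measure_le hA hB (hAt.trans hBt)
  -- If level `t` is missed, the chain jumps from `A` to `B`. Half of the gap added to `A` stays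
  -- comparable with the whole chain, so by maximality it belongs to it, yet it lies strictly inside
  -- the jump.
  have hpos : 0 < P ((B : Set Ω) \ A) :=
    (tsub_pos_of_lt (hlt.trans_le hBt)).trans_le (le_measure_sdiff)
  obtain ⟨D, D', hD, hD', hU, hdisj, hDpos, hDpos'⟩ := hP _ (B.2.diff A.2) hpos
  have hDsub : D ⊆ (B : Set Ω) \ A := hU ▸ subset_union_left
  have hDsub' : D' ⊆ (B : Set Ω) \ A := hU ▸ subset_union_right
  have hN : (⟨(A : Set Ω) ∪ D, A.2.union hD⟩ : {A : Set Ω // MeasurableSet A}) ∈ M := by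
    refine hM.mem_of_aesubset_total fun C hC => ?_
    rcases le_or_gt (P (C : Set Ω)) t with h | h
    · right
      filter_upwards [hAmax C hC h] with ω hω hmem using Or.inl (hω hmem)
    · left
      filter_upwards [hBmin C hC h, hAB] with ω hω hω' hmem
      rcases hmem with hmem | hmem
      · exact hω (hω' hmem)
      · exact hω (hDsub hmem).1
  rcases le_or_gt (P ((A : Set Ω) ∪ D)) t with h | h
  · refine hDpos.ne' (measure_mono_null ?_ (ae_iff.1 (hAmax _ hN h)))
    exact fun ω hω hmem => (hDsub hω).2 (hmem (Or.inr hω))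
  · refine hDpos'.ne' (measure_mono_null ?_ (ae_iff.1 (hBmin _ hN h)))
    intro ω hω hmem
    rcases hmem (hDsub' hω).1 with h' | h'
    · exact (hDsub' hω).2 h'
    · exact disjoint_left.1 hdisj h' hω

end Chains

/-! ### Antimonotone rearrangement -/

section Rearrangement

variable {Ω : Type*} [MeasurableSpace Ω] {P : Measure Ω}

/-- On an atomless probability space every random variable `X` has a copy `X'` with the same
distribution that is antimonotone with respect to a given random variable `Z`: every sublevel set
of `X'` is almost surely comparable with every superlevel set of `Z`. -/
theorem exists_antimonotone_rearrangement [IsProbabilityMeasure P] (hP : IsAtomless P)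
    {X Z : Ω → ℝ} (hX : Measurable X) (hZ : Measurable Z) :
    ∃ X' : Ω → ℝ, Measurable X' ∧ P.map X' = P.map X ∧
      ∀ s c : ℝ, {ω | X' ω < s} ≤ᵐ[P] {ω | c < Z ω} ∨ {ω | c < Z ω} ≤ᵐ[P] {ω | X' ω < s} := by
  have hZm : ∀ c, MeasurableSet {ω | c < Z ω} := fun c => measurableSet_lt measurable_const hZ
  have hchain : IsChain (AESubset P) (range fun c : ℝ =>
      (⟨{ω | c < Z ω}, hZm c⟩ : {A : Set Ω // MeasurableSet A})) := by
    rintro _ ⟨c, rfl⟩ _ ⟨d, rfl⟩ -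
    rcases le_total c d with h | h
    · exact Or.inr (ae_of_all _ fun ω hω => h.trans_lt hω)
    · exact Or.inl (ae_of_all _ fun ω hω => h.trans_lt hω)
  obtain ⟨M, hM, hsub⟩ := hchain.exists_maxChain
  choose A hAM hAP using fun q : ℚ =>
    hM.exists_measure_eq hP (t := P {ω | X ω < q}) (measure_mono (subset_univ _))
  have hmono : ∀ q r : ℚ, q ≤ r → (A q : Set Ω) ≤ᵐ[P] (A r : Set Ω) := fun q r hqr =>
    hM.aesubset_of_measure_le (hAM q) (hAM r) (by
      rw [hAP, hAP]
      exact measure_mono fun ω (hω : X ω < q) =>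
        show X ω < r from hω.trans_le (by exact_mod_cast hqr))
  classical
  -- The infimum may be infinite on a null set, so the copy is first built in `EReal`.
  set Y : Ω → EReal := fun ω => ⨅ q : ℚ, if ω ∈ (A q : Set Ω) then ((q : ℝ) : EReal) else ⊤
    with hY
  have hYm : Measurable Y :=
    Measurable.iInf fun q => Measurable.ite (A q).2 measurable_const measurable_const
  have hYlt : ∀ s : EReal, {ω | Y ω < s} =
      ⋃ q : {q : ℚ // ((q : ℝ) : EReal) < s}, (A q : Set Ω) := by
    intro s
    ext ω
    simp only [hY, mem_ofPred_eq, iInf_lt_iff, mem_iUnion, Subtype.exists, exists_prop]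
    refine exists_congr fun q => ?_
    by_cases h : ω ∈ (A q : Set Ω) <;> simp [h]
  have hXlt : ∀ s : EReal, {ω | (X ω : EReal) < s} =
      ⋃ q : {q : ℚ // ((q : ℝ) : EReal) < s}, {ω | X ω < ((q : ℚ) : ℝ)} := by
    intro s
    ext ω
    simp only [mem_ofPred_eq, mem_iUnion, Subtype.exists, exists_prop]
    constructor
    · intro h
      obtain ⟨q, hq, hq'⟩ := EReal.lt_iff_exists_rat_btwn.1 h
      exact ⟨q, hq', by exact_mod_cast hq⟩
    · rintro ⟨q, hq, hq'⟩
      exact lt_trans (by exact_mod_cast hq') hq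
  have hXe : Measurable fun ω => (X ω : EReal) := measurable_coe_real_ereal.comp hX
  have hmeas : ∀ s : EReal, P {ω | Y ω < s} = P {ω | (X ω : EReal) < s} := by
    intro s
    have hA : ∀ i j : {q : ℚ // ((q : ℝ) : EReal) < s}, i ≤ j →
        (A i : Set Ω) ≤ᵐ[P] (A j : Set Ω) := fun i j hij => hmono i j hij
    have hB : ∀ i j : {q : ℚ // ((q : ℝ) : EReal) < s}, i ≤ j →
        {ω | X ω < ((i : ℚ) : ℝ)} ≤ᵐ[P] {ω | X ω < ((j : ℚ) : ℝ)} := fun i j hij =>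
      ae_of_all _ fun ω (hω : X ω < ((i : ℚ) : ℝ)) =>
        show X ω < ((j : ℚ) : ℝ) from hω.trans_le (by exact_mod_cast hij)
    rw [hYlt, hXlt, measure_iUnion_of_ae_mono hA, measure_iUnion_of_ae_mono hB]
    exact iSup_congr fun q => hAP q
  have hmap : P.map Y = P.map fun ω => (X ω : EReal) := by
    have := Measure.isProbabilityMeasure_map (μ := P) hYm.aemeasurable
    refine Measure.ext_of_Ici _ _ fun s => ?_
    have h1 : Y ⁻¹' Ici s = {ω | Y ω < s}ᶜ := by ext ω; simp
    have h2 : (fun ω => (X ω : EReal)) ⁻¹' Ici s = {ω | (X ω : EReal) < s}ᶜ := by ext ω; simp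
    rw [Measure.map_apply hYm measurableSet_Ici, Measure.map_apply hXe measurableSet_Ici, h1, h2,
      prob_compl_eq_one_sub (measurableSet_lt hYm measurable_const),
      prob_compl_eq_one_sub (measurableSet_lt hXe measurable_const), hmeas]
  -- Almost sure finiteness depends only on the law, which is that of `X`.
  have hfin : ∀ᵐ ω ∂P, ((Y ω).toReal : EReal) = Y ω := by
    have hs : MeasurableSet {y : EReal | ((y.toReal : ℝ) : EReal) = y} :=
      measurableSet_eq_fun (measurable_coe_real_ereal.comp measurable_ereal_toReal)
        measurable_id
    have h : ∀ᵐ y ∂(P.map Y), ((y.toReal : ℝ) : EReal) = y := by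
      rw [hmap, ae_map_iff hXe.aemeasurable hs]
      exact ae_of_all _ fun ω => by simp
    exact (ae_map_iff hYm.aemeasurable hs).1 h
  refine ⟨fun ω => (Y ω).toReal, measurable_ereal_toReal.comp hYm, ?_, fun s c => ?_⟩
  · calc P.map (fun ω => (Y ω).toReal) = (P.map Y).map EReal.toReal :=
          (Measure.map_map measurable_ereal_toReal hYm).symm
      _ = P.map X := by
          rw [hmap, Measure.map_map measurable_ereal_toReal hXe]
          rfl
  · have heq : {ω | (Y ω).toReal < s} =ᵐ[P]
        ⋃ q : {q : ℚ // ((q : ℝ) : EReal) < (s : EReal)}, (A q : Set Ω) := by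
      rw [← hYlt]
      filter_upwards [hfin] with ω hω
      refine propext ?_
      change (Y ω).toReal < s ↔ Y ω < s
      rw [← EReal.coe_lt_coe_iff, hω]
    -- Sublevel sets are countable unions of chain members, so they are in the chain, as are the
    -- superlevel sets of `Z`.
    rcases hM.aesubset_total (hM.iUnion_mem fun q : {q : ℚ // ((q : ℝ) : EReal) < (s : EReal)} =>
      hAM q) (hsub ⟨c, rfl⟩) with h | h
    · exact Or.inl (heq.le.trans h)
    · exact Or.inr (EventuallyLE.trans h heq.symm.le)

end Rearrangement

/-! ### Self-adjointness of conditional expectation and the Hardy-Littlewood inequality -/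

section CondExp

variable {Ω : Type*} {m mΩ : MeasurableSpace Ω} {P : Measure Ω}

theorem lintegral_mul_condLExp (hm : m ≤ mΩ) [SigmaFinite (P.trim hm)] {f g : Ω → ℝ≥0∞}
    (hf : Measurable f) (hg : Measurable[m] g) :
    ∫⁻ ω, condLExp m P f ω * g ω ∂P = ∫⁻ ω, f ω * g ω ∂P := by
  have h : (P.withDensity (condLExp m P f)).trim hm = (P.withDensity f).trim hm := by
    refine @Measure.ext _ m _ _ fun s hs => ?_
    rw [trim_measurableSet_eq hm hs, trim_measurableSet_eq hm hs, withDensity_apply _ (hm s hs),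
      withDensity_apply _ (hm s hs), setLIntegral_condLExp hm P f hs]
  have hg' : Measurable g := hg.mono hm le_rfl
  calc ∫⁻ ω, condLExp m P f ω * g ω ∂P = ∫⁻ ω, g ω ∂(P.withDensity (condLExp m P f)) :=
        (lintegral_withDensity_eq_lintegral_mul _ (measurable_condLExp' m P f) hg').symm
    _ = ∫⁻ ω, g ω ∂(P.withDensity f) := by rw [← lintegral_trim hm hg, h, lintegral_trim hm hg]
    _ = ∫⁻ ω, f ω * g ω ∂P := lintegral_withDensity_eq_lintegral_mul _ hf hg'

theorem lintegral_condLExp_mul_comm (hm : m ≤ mΩ) [SigmaFinite (P.trim hm)] {f g : Ω → ℝ≥0∞}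
    (hf : Measurable f) (hg : Measurable g) :
    ∫⁻ ω, condLExp m P f ω * g ω ∂P = ∫⁻ ω, f ω * condLExp m P g ω ∂P := by
  rw [← lintegral_mul_condLExp hm hf (measurable_condLExp m P g)]
  simp_rw [mul_comm (condLExp m P f _)]
  exact (lintegral_mul_condLExp hm hg (measurable_condLExp m P f)).symm

/-- The Hardy-Littlewood inequality: among all functions with values in `[0, 1]` and with a given
integral, the integral against `Z` is greatest for the indicator of a set comparable with all
superlevel sets of `Z`. -/
theorem lintegral_mul_le_setLIntegral_of_comparable [IsProbabilityMeasure P] {Z : Ω → ℝ}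
    (hZ : Measurable Z) (hZ0 : 0 ≤ Z) {φ : Ω → ℝ≥0∞} (hφ : Measurable φ) (hφ1 : φ ≤ᵐ[P] 1)
    {A : Set Ω}
    (hcomp : ∀ c : ℝ, A ≤ᵐ[P] {ω | c < Z ω} ∨ {ω | c < Z ω} ≤ᵐ[P] A)
    (hφA : ∫⁻ ω, φ ω ∂P = P A) :
    ∫⁻ ω, φ ω * ENNReal.ofReal (Z ω) ∂P ≤ ∫⁻ ω in A, ENNReal.ofReal (Z ω) ∂P := by
  calc ∫⁻ ω, φ ω * ENNReal.ofReal (Z ω) ∂P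
      = ∫⁻ ω, ENNReal.ofReal (Z ω) ∂(P.withDensity φ) :=
        (lintegral_withDensity_eq_lintegral_mul _ hφ hZ.ennreal_ofReal).symm
    _ = ∫⁻ c in Ioi 0, P.withDensity φ {ω | c < Z ω} :=
        lintegral_eq_lintegral_meas_lt _ (ae_of_all _ hZ0) hZ.aemeasurable
    _ ≤ ∫⁻ c in Ioi 0, P.restrict A {ω | c < Z ω} := by
        refine lintegral_mono fun c => ?_
        have hc : MeasurableSet {ω | c < Z ω} := measurableSet_lt measurable_const hZ
        rw [withDensity_apply _ hc, Measure.restrict_apply hc]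
        -- The mass of φ on {Z > c} is at most both P(A) and P(Z > c); comparability makes P(A ∩ {Z
        -- > c}) the smaller of the two.
        rcases hcomp c with h | h
        · calc ∫⁻ ω in {ω | c < Z ω}, φ ω ∂P ≤ ∫⁻ ω, φ ω ∂P := setLIntegral_le_lintegral _ _
            _ = P A := hφA
            _ ≤ P ({ω | c < Z ω} ∩ A) :=
              measure_mono_ae (by filter_upwards [h] with ω hω hmem using ⟨hω hmem, hmem⟩)
        · calc ∫⁻ ω in {ω | c < Z ω}, φ ω ∂P ≤ ∫⁻ ω in {ω | c < Z ω}, 1 ∂P :=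
                lintegral_mono_ae (ae_restrict_of_ae hφ1)
            _ = P {ω | c < Z ω} := by simp
            _ ≤ P ({ω | c < Z ω} ∩ A) :=
              measure_mono_ae (by filter_upwards [h] with ω hω hmem using ⟨hmem, hω hmem⟩)
    _ = ∫⁻ ω in A, ENNReal.ofReal (Z ω) ∂P :=
        (lintegral_eq_lintegral_meas_lt _ (ae_of_all _ hZ0) hZ.aemeasurable).symm

end CondExp

/-! ### Stability of the determining set and conditioning of positions -/

section Utility

variable {Ω : Type*} {m mΩ : MeasurableSpace Ω} {P : Measure Ω}

theorem lintegral_ofReal_eq_lintegral_measure_le (μ : Measure Ω) {f : Ω → ℝ}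
    (hf : Measurable f) :
    ∫⁻ ω, ENNReal.ofReal (f ω) ∂μ = ∫⁻ t in Ioi 0, μ {ω | t ≤ f ω} := by
  have h := lintegral_eq_lintegral_meas_le μ (f := fun ω => max (f ω) 0)
    (ae_of_all _ fun ω => le_max_right _ _) (hf.max measurable_const).aemeasurable
  simp only [ENNReal.ofReal_max, ENNReal.ofReal_zero, zero_le, max_eq_left] at h
  rw [h]
  refine setLIntegral_congr_fun measurableSet_Ioi fun t ht => ?_
  simp only [le_max_iff, not_le.2 (mem_Ioi.1 ht), or_false]

theorem lintegral_ofReal_eq_lintegral_measure_lt (μ : Measure Ω) {f : Ω → ℝ}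
    (hf : Measurable f) :
    ∫⁻ ω, ENNReal.ofReal (f ω) ∂μ = ∫⁻ t in Ioi 0, μ {ω | t < f ω} := by
  have h := lintegral_eq_lintegral_meas_lt μ (f := fun ω => max (f ω) 0)
    (ae_of_all _ fun ω => le_max_right _ _) (hf.max measurable_const).aemeasurable
  simp only [ENNReal.ofReal_max, ENNReal.ofReal_zero, zero_le, max_eq_left] at h
  rw [h]
  refine setLIntegral_congr_fun measurableSet_Ioi fun t ht => ?_
  simp only [lt_max_iff, not_lt.2 (mem_Ioi.1 ht).le, or_false]

/-- Stochastic dominance via the layer-cake formula. Using ≤ for positive parts and < for negative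
parts reduces both to the sets {X < s}. -/
theorem extExpectation_le_of_measure_lt_le {Q Q' : Measure Ω} [IsProbabilityMeasure Q]
    [IsProbabilityMeasure Q'] {X X' : Ω → ℝ} (hX : Measurable X) (hX' : Measurable X')
    (h : ∀ s : ℝ, Q' {ω | X ω < s} ≤ Q {ω | X' ω < s}) :
    extExpectation Q X' ≤ extExpectation Q' X := by
  have hpos : ∫⁻ ω, ENNReal.ofReal (X' ω) ∂Q ≤ ∫⁻ ω, ENNReal.ofReal (X ω) ∂Q' := by
    rw [lintegral_ofReal_eq_lintegral_measure_le Q hX',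
      lintegral_ofReal_eq_lintegral_measure_le Q' hX]
    refine lintegral_mono fun t => ?_
    have hset : ∀ V : Ω → ℝ, {ω | t ≤ V ω} = {ω | V ω < t}ᶜ := fun V => by
      ext ω
      simp
    rw [hset, hset, prob_compl_eq_one_sub (measurableSet_lt hX' measurable_const),
      prob_compl_eq_one_sub (measurableSet_lt hX measurable_const)]
    exact tsub_le_tsub_left (h t) 1
  have hneg : ∫⁻ ω, ENNReal.ofReal (-X ω) ∂Q' ≤ ∫⁻ ω, ENNReal.ofReal (-X' ω) ∂Q := by
    rw [lintegral_ofReal_eq_lintegral_measure_lt Q' (f := fun ω => -X ω) hX.neg,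
      lintegral_ofReal_eq_lintegral_measure_lt Q (f := fun ω => -X' ω) hX'.neg]
    refine lintegral_mono fun t => ?_
    simp only [lt_neg]
    exact h (-t)
  exact EReal.sub_le_sub (by exact_mod_cast hpos) (by exact_mod_cast hneg)

/-- The determining set of a law invariant coherent utility is stable under conditioning
of the densities. -/
theorem withDensity_condLExp_mem_determiningSet [IsProbabilityMeasure P] (hP : IsAtomless P)
    {u : (Ω → ℝ) → EReal} (hlaw : IsLawInvariant P u) {Q : Measure Ω}
    (hQ : Q ∈ determiningSet P u) (hm : m ≤ mΩ) :
    P.withDensity (condLExp m P (Q.rnDeriv P)) ∈ determiningSet P u := by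
  obtain ⟨⟨hQp, hQac⟩, hQu⟩ := hQ
  set Q' := P.withDensity (condLExp m P (Q.rnDeriv P)) with hQ'
  have hQd : P.withDensity (Q.rnDeriv P) = Q := Measure.withDensity_rnDeriv_eq Q P hQac
  have hQ'p : IsProbabilityMeasure Q' := by
    constructor
    rw [hQ', withDensity_apply _ MeasurableSet.univ, Measure.restrict_univ,
      lintegral_condLExp hm, Measure.lintegral_rnDeriv hQac, measure_univ]
  refine ⟨⟨hQ'p, withDensity_absolutelyContinuous _ _⟩, fun X hX => ?_⟩
  have hZm : Measurable fun ω => (Q.rnDeriv P ω).toReal :=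
    (Measure.measurable_rnDeriv Q P).ennreal_toReal
  have hZeq : (fun ω => ENNReal.ofReal (Q.rnDeriv P ω).toReal) =ᵐ[P] Q.rnDeriv P := by
    filter_upwards [Measure.rnDeriv_ne_top Q P] with ω hω using ENNReal.ofReal_toReal hω
  obtain ⟨X', hX', hmap, hcomp⟩ := exists_antimonotone_rearrangement hP hX hZm
  rw [hlaw X X' hX hX' hmap.symm]
  refine (hQu X' hX').trans (extExpectation_le_of_measure_lt_le hX hX' fun s => ?_)
  have hA : MeasurableSet {ω | X ω < s} := measurableSet_lt hX measurable_const
  have hA' : MeasurableSet {ω | X' ω < s} := measurableSet_lt hX' measurable_const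
  have hPA : P {ω | X ω < s} = P {ω | X' ω < s} := by
    have h := congrArg (fun μ => μ (Iio s)) hmap
    simp only [Measure.map_apply hX measurableSet_Iio,
      Measure.map_apply hX' measurableSet_Iio] at h
    exact h.symm
  set φ := condLExp m P ({ω | X ω < s}.indicator 1)
  have hind : Measurable ({ω | X ω < s}.indicator (1 : Ω → ℝ≥0∞)) := measurable_one.indicator hA
  have hφ1 : φ ≤ᵐ[P] 1 := by
    have h : condLExp m P (1 : Ω → ℝ≥0∞) = 1 := condLExp_eq_self hm P measurable_const
    rw [← h]
    exact condLExp_mono (ae_of_all _ fun ω => indicator_le_self' (fun _ _ => zero_le) ω)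
  calc Q' {ω | X ω < s}
      = ∫⁻ ω, condLExp m P (Q.rnDeriv P) ω * {ω | X ω < s}.indicator 1 ω ∂P := by
        rw [hQ', withDensity_apply _ hA, ← lintegral_indicator hA]
        refine lintegral_congr fun ω => ?_
        by_cases h : X ω < s <;> simp [indicator, h]
    _ = ∫⁻ ω, Q.rnDeriv P ω * φ ω ∂P :=
        lintegral_condLExp_mul_comm hm (Measure.measurable_rnDeriv Q P) hind
    _ = ∫⁻ ω, φ ω * ENNReal.ofReal (Q.rnDeriv P ω).toReal ∂P := by
        refine lintegral_congr_ae ?_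
        filter_upwards [hZeq] with ω hω
        rw [hω, mul_comm]
    _ ≤ ∫⁻ ω in {ω | X' ω < s}, ENNReal.ofReal (Q.rnDeriv P ω).toReal ∂P := by
        refine lintegral_mul_le_setLIntegral_of_comparable hZm
          (fun ω => ENNReal.toReal_nonneg) (measurable_condLExp' m P _) hφ1 (hcomp s) ?_
        rw [lintegral_condLExp hm, lintegral_indicator_one hA, hPA]
    _ = ∫⁻ ω in {ω | X' ω < s}, Q.rnDeriv P ω ∂P :=
        lintegral_congr_ae (ae_restrict_of_ae hZeq)
    _ = Q {ω | X' ω < s} := by rw [← withDensity_apply _ hA', hQd]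

/-- Only an inequality survives: if b = ∞ the left side is -∞ by convention, whatever the right side
is. -/
theorem coe_ennreal_sub_le_of_add_eq {a b p n : ℝ≥0∞} (hnb : n ≤ b) (h : p + b = n + a) :
    (a : EReal) - (b : EReal) ≤ (p : EReal) - (n : EReal) := by
  rcases eq_or_ne b ⊤ with rfl | hb
  · simp
  have hn : n ≠ ⊤ := ne_top_of_le_ne_top hb hnb
  lift b to NNReal using hb
  lift n to NNReal using hn
  rcases eq_or_ne p ⊤ with rfl | hp
  · exact le_top.trans_eq (EReal.top_sub_coe (n : ℝ)).symm
  lift p to NNReal using hp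
  have ha : a ≠ ⊤ := fun ha => by simp [ha] at h
  lift a to NNReal using ha
  have h' : (p : ℝ) + b = n + a := by exact_mod_cast h
  simp only [EReal.coe_nnreal_eq_coe_real, ← EReal.coe_sub, EReal.coe_le_coe_iff]
  linarith

theorem extExpectation_withDensity_condLExp_le [IsProbabilityMeasure P] {Q : Measure Ω}
    [IsProbabilityMeasure Q] (hQ : Q ≪ P) (hm : m ≤ mΩ)
    {X V : Ω → ℝ} (hX : Measurable X)
    (hXV : ∀ᵐ ω ∂P, (V ω : EReal) = extCondExp P m X ω) :
    extExpectation (P.withDensity (condLExp m P (Q.rnDeriv P))) X ≤ extExpectation Q V := by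
  have hQd : P.withDensity (Q.rnDeriv P) = Q := Measure.withDensity_rnDeriv_eq Q P hQ
  have key : ∀ g : Ω → ℝ≥0∞, Measurable g →
      ∫⁻ ω, g ω ∂(P.withDensity (condLExp m P (Q.rnDeriv P))) = ∫⁻ ω, condLExp m P g ω ∂Q := by
    intro g hg
    calc ∫⁻ ω, g ω ∂(P.withDensity (condLExp m P (Q.rnDeriv P)))
        = ∫⁻ ω, condLExp m P (Q.rnDeriv P) ω * g ω ∂P :=
          lintegral_withDensity_eq_lintegral_mul _ (measurable_condLExp' m P _) hg
      _ = ∫⁻ ω, Q.rnDeriv P ω * condLExp m P g ω ∂P :=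
          lintegral_condLExp_mul_comm hm (Measure.measurable_rnDeriv Q P) hg
      _ = ∫⁻ ω, condLExp m P g ω ∂(P.withDensity (Q.rnDeriv P)) :=
          (lintegral_withDensity_eq_lintegral_mul _ (Measure.measurable_rnDeriv Q P)
            (measurable_condLExp' m P g)).symm
      _ = ∫⁻ ω, condLExp m P g ω ∂Q := by rw [hQd]
  unfold extExpectation
  rw [key _ hX.ennreal_ofReal, key (fun ω => ENNReal.ofReal (-X ω)) hX.neg.ennreal_ofReal]
  set a := condLExp m P fun ω => ENNReal.ofReal (X ω)
  set b := condLExp m P fun ω => ENNReal.ofReal (-X ω)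
  have ham : Measurable a := measurable_condLExp' m P _
  have hbm : Measurable b := measurable_condLExp' m P _
  have hVab : ∀ᵐ ω ∂Q, ENNReal.ofReal (-V ω) ≤ b ω ∧
      ENNReal.ofReal (V ω) + b ω = ENNReal.ofReal (-V ω) + a ω := by
    filter_upwards [hQ.ae_le hXV] with ω hω
    have hω' : (V ω : EReal) = (a ω : EReal) - (b ω : EReal) := hω
    generalize a ω = x at hω'
    generalize b ω = y at hω'
    -- Since `V` is finite, so are both conditional expectations: b = ∞ would give -∞, and then a =
    -- ∞ would give ∞.
    induction y with
    | top => simp at hω'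
    | coe y =>
      induction x with
      | top =>
        exact absurd (hω'.trans (EReal.top_sub_coe (y : ℝ))) (EReal.coe_ne_top _)
      | coe x =>
        have hVr : V ω = (x : ℝ) - y := by
          simpa only [EReal.coe_nnreal_eq_coe_real, ← EReal.coe_sub, EReal.coe_eq_coe_iff]
            using hω'
        have h1 : ((x : ℝ≥0∞)) = ENNReal.ofReal x := by simp
        have h2 : ((y : ℝ≥0∞)) = ENNReal.ofReal y := by simp
        rw [h1, h2, hVr]
        refine ⟨ENNReal.ofReal_le_ofReal (by linarith [x.coe_nonneg]), ?_⟩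
        rcases le_total (x : ℝ) y with h | h
        · rw [ENNReal.ofReal_of_nonpos (sub_nonpos.2 h), zero_add,
            ← ENNReal.ofReal_add (by linarith) x.coe_nonneg]
          congr 1
          ring
        · rw [ENNReal.ofReal_of_nonpos (p := -((x : ℝ) - y)) (by linarith), zero_add,
            ← ENNReal.ofReal_add (by linarith) y.coe_nonneg]
          congr 1
          ring
  have hle : ∫⁻ ω, ENNReal.ofReal (-V ω) ∂Q ≤ ∫⁻ ω, b ω ∂Q :=
    lintegral_mono_ae (hVab.mono fun ω h => h.1)
  have heq : ∫⁻ ω, ENNReal.ofReal (V ω) ∂Q + ∫⁻ ω, b ω ∂Q =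
      ∫⁻ ω, ENNReal.ofReal (-V ω) ∂Q + ∫⁻ ω, a ω ∂Q := by
    rw [← lintegral_add_right _ hbm, ← lintegral_add_right _ ham]
    exact lintegral_congr_ae (hVab.mono fun ω h => h.2)
  exact coe_ennreal_sub_le_of_add_eq hle heq

end Utility

theorem theorem3p7 {Ω : Type*} [MeasurableSpace Ω] (P : Measure Ω) [IsProbabilityMeasure P]
    (hP : IsAtomless P) (u : (Ω → ℝ) → EReal) (hu : IsCoherentUtility P u)
    (hlaw : IsLawInvariant P u) :
    (∀ (X : Ω → ℝ) (k l : ℕ) (Y : Ω → Fin k → ℝ) (Y' : Ω → Fin l → ℝ),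
      Measurable X → Measurable Y → Measurable Y' →
      factorUtility P u X (fun ω => (Y ω, Y' ω)) ≤ factorUtility P u X Y) ∧
    IsDilatationMonotone P (fun X => -u X) := by
  have hrep := (isGreatest_determiningSet hu).1.2.2
  refine ⟨fun X k l Y Y' hX hY hY' => ?_, fun X V hX hV m hm hXV => ?_⟩
  · refine le_iInf₂ fun Q' hQ' => iInf₂_le Q' ?_
    obtain ⟨Q, hQ, rfl⟩ := hQ'
    -- The conditioned measure is its own witness: its density is already measurable for the finer
    -- σ-algebra.
    refine ⟨condMeasure P Y Q,
      withDensity_condLExp_mem_determiningSet hP hlaw hQ hY.comap_le, ?_⟩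
    have hle : MeasurableSpace.comap Y inferInstance ≤
        MeasurableSpace.comap (fun ω => (Y ω, Y' ω)) inferInstance := by
      rintro _ ⟨s, hs, rfl⟩
      exact ⟨Prod.fst ⁻¹' s, measurable_fst hs, rfl⟩
    have hm := (hY.prodMk hY').comap_le
    unfold condMeasure
    refine withDensity_congr_ae ?_
    refine (condLExp_congr_ae (Measure.rnDeriv_withDensity P
      (measurable_condLExp' _ P (Q.rnDeriv P)))).trans ?_
    rw [condLExp_eq_self hm P ((measurable_condLExp _ P _).mono hle le_rfl)]
  · rw [EReal.neg_le_neg_iff, hrep V hV]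
    refine le_iInf₂ fun Q hQ => ?_
    have := hQ.1.1
    exact ((withDensity_condLExp_mem_determiningSet hP hlaw hQ hm).2 X hX).trans
      (extExpectation_withDensity_condLExp_le hQ.1.2 hm hX hXV)
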